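/- By a Cantor set we mean a non-empty, compact, metrizable, totally disconnected topological space without isolated points. Let $X$ be a Cantor set and let $\phi:X\to X$ be a minimal homeomorphism, i.e. for every $x\in X$ the orbit $\{\phi^n(x)\mid n\in\mathbb Z\}$ is dense in $X$. The topological full group $[[\phi]]$ is the group of all homeomorphisms $\psi:X\to X$ for which there is a continuous map $c:X\to\mathbb Z$ with $\psi(x)=\phi^{c(x)}(x)$ for all $x\in X$, and $D([[\phi]])$ is its commutator subgroup. We say that $(X,\phi)$ is an odometer if there is a sequence $(m_n)_n$ of positive integers with $m_n\mid m_{n+1}$ for all $n$ and $m_n\to\infty$ such that $(X,\phi)$ is topologically conjugate to the map $(x_n)_n\mapsto(x_n+1)_n$ on the inverse limit of the groups $\mathbb Z/m_n\mathbb Z$ along the canonical reductions $\mathbb Z/m_{n+1}\mathbb Z\to\mathbb Z/m_n\mathbb Z$ (with the topology induced by the product of the discrete topologies). Let $L=\left(\bigoplus_{\mathbb Z}\mathbb Z/2\mathbb Z\right)\rtimes\mathbb Z$ be the lamplighter group, where $\mathbb Z$ acts by shifting the coordinates. Then the following three conditions are equivalent: 1. $(X,\phi)$ is not an odometer. 2.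 $D([[\phi]])$ contains a subgroup isomorphic to $L$. 3. $[[\phi]]$ contains a subgroup isomorphic to $L$. -/

import Mathlib

/-- The topological full group `[[φ]]` of a homeomorphism `φ`: all homeomorphisms `ψ` for which
there is a continuous `c : X → ℤ` with `ψ x = φ ^ (c x) x` for all `x`. The multiplication of
`X ≃ₜ X` is composition. -/
def topFullGroup {X : Type*} [TopologicalSpace X] (φ : X ≃ₜ X) : Subgroup (X ≃ₜ X) where
  carrier := {ψ | ∃ c : X → ℤ, Continuous c ∧ ∀ x, ψ x = (φ ^ c x) x}
  mul_mem' := by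
    rintro a b ⟨c, hc, ha⟩ ⟨d, hd, hb⟩
    refine ⟨fun x => c (b x) + d x, (hc.comp b.continuous).add hd, fun x => ?_⟩
    rw [Homeomorph.mul_apply, ha, zpow_add, Homeomorph.mul_apply, ← hb]
  one_mem' := ⟨fun _ => 0, continuous_const, fun x => by simp⟩
  inv_mem' := by
    rintro a ⟨c, hc, ha⟩
    refine ⟨fun x => -c (a⁻¹ x), (hc.comp (a⁻¹).continuous).neg, fun x => ?_⟩
    have h : x = (φ ^ c (a⁻¹ x)) (a⁻¹ x) := by
      rw [← ha, ← Homeomorph.mul_apply, mul_inv_cancel, Homeomorph.one_apply]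
    conv_rhs => arg 2; rw [h]
    rw [← Homeomorph.mul_apply, ← zpow_add, neg_add_cancel, zpow_zero, Homeomorph.one_apply]

/-- A homeomorphism is minimal if all its (two-sided) orbits are dense. -/
def IsMinimalHomeo {X : Type*} [TopologicalSpace X] (φ : X ≃ₜ X) : Prop :=
  ∀ x : X, Dense {y : X | ∃ n : ℤ, y = (φ ^ n) x}

/-- The inverse limit of the groups `ℤ/m n` along the canonical reductions
`ℤ/m (n+1) → ℤ/m n`, with the topology induced from the product of the discrete groups. -/
abbrev OdometerSpace (m : ℕ → ℕ) (h : ∀ n, m n ∣ m (n + 1)) : Type :=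
  {x : (n : ℕ) → ZMod (m n) // ∀ n, ZMod.castHom (h n) (ZMod (m n)) (x (n + 1)) = x n}

/-- The odometer map: addition of `1` in every coordinate. -/
def odometerMap (m : ℕ → ℕ) (h : ∀ n, m n ∣ m (n + 1)) :
    OdometerSpace m h ≃ₜ OdometerSpace m h where
  toFun x := ⟨fun n => x.1 n + 1, fun n => by rw [map_add, map_one, x.2 n]⟩
  invFun x := ⟨fun n => x.1 n - 1, fun n => by rw [map_sub, map_one, x.2 n]⟩
  left_inv x := Subtype.ext (funext fun n => add_sub_cancel_right (x.1 n) 1)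
  right_inv x := Subtype.ext (funext fun n => sub_add_cancel (x.1 n) 1)
  continuous_toFun := Continuous.subtype_mk (continuous_pi fun n =>
    (continuous_of_discreteTopology (f := fun z : ZMod (m n) => z + 1)).comp
      ((continuous_apply n).comp continuous_subtype_val)) _
  continuous_invFun := Continuous.subtype_mk (continuous_pi fun n =>
    (continuous_of_discreteTopology (f := fun z : ZMod (m n) => z - 1)).comp
      ((continuous_apply n).comp continuous_subtype_val)) _

/-- `φ` is an odometer: it is topologically conjugate to the odometer of type `(m n)` for some
sequence with `m n ∣ m (n + 1)` and `m n → ∞` (which forces every `m n` to be positive). -/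
def IsOdometer {X : Type*} [TopologicalSpace X] (φ : X ≃ₜ X) : Prop :=
  ∃ (m : ℕ → ℕ) (h : ∀ n, m n ∣ m (n + 1)), Filter.Tendsto m Filter.atTop Filter.atTop ∧
    ∃ f : X ≃ₜ OdometerSpace m h, ∀ x, f (φ x) = odometerMap m h (f x)

/-- The shift action of `ℤ` on `⨁_ℤ ℤ/2`: the integer `k` moves the basis element at `i` to the
basis element at `k + i`. -/
noncomputable def lampShift : Multiplicative ℤ →* MulAut (Multiplicative (ℤ →₀ ZMod 2)) where
  toFun k := AddEquiv.toMultiplicative (Finsupp.domCongr (Equiv.addLeft k.toAdd))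
  map_one' := by
    refine MulEquiv.ext fun v => Finsupp.ext fun i => ?_
    change v.toAdd (-0 + i) = v.toAdd i
    simp
  map_mul' a b := by
    refine MulEquiv.ext fun v => Finsupp.ext fun i => ?_
    change v.toAdd (-(a.toAdd + b.toAdd) + i) = v.toAdd (-b.toAdd + (-a.toAdd + i))
    congr 1
    ring

/-- The lamplighter group `(⨁_ℤ ℤ/2) ⋊ ℤ`. -/
abbrev Lamplighter : Type :=
  SemidirectProduct (Multiplicative (ℤ →₀ ZMod 2)) (Multiplicative ℤ) lampShift

/-- The group `G` contains (an isomorphic copy of) the lamplighter group as a subgroup. -/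
def ContainsLamplighter (G : Type*) [Group G] : Prop :=
  ∃ H : Subgroup G, Nonempty (Lamplighter ≃* H)

/-! An odometer is nearly finite: by compactness, the cocycles of two elements of the full group
factor through one cyclic quotient `ℤ/m`. Both elements then permute `ℤ/m`. A positive power of one
of them acts trivially there, hence as a single power of `φ` on each level, and so commutes with its
conjugates of the same kind. In the lamplighter group no nontrivial power of the shift commutes with
its conjugate by the lamp.

Conversely, a minimal system in which each clopen set is invariant under some positive power of `φ`
is an odometer, with itineraries giving the coordinates (`isOdometer_of_forall_isClopen_periodic`).
If `φ` is not one, choose a clopen `U` disjoint from its next three translates, with first return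
map `α`. By `exists_period_of_firstReturn` some clopen `B ⊆ U` is not `α`-periodic. The
`α`-translates of its indicator are then independent over `ℤ/2`, since a relation would be a linear
recurrence over a finite field. Lamps become involutions exchanging subsets of `U` with their images
under `φ`, and the shift becomes `α` acting on `U` and `φ U` simultaneously. Multiplying by a
reflected copy with disjoint support lands in the commutator subgroup, because an element times its
reflection dies in every abelian quotient (`map_mul_map_reflect`). -/

theorem containsLamplighter_iff {G : Type*} [Group G] :
    ContainsLamplighter G ↔ ∃ ι : Lamplighter →* G, Function.Injective ι := by
  constructor
  · rintro ⟨H, ⟨e⟩⟩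
    exact ⟨H.subtype.comp e.toMonoidHom, H.subtype_injective.comp e.injective⟩
  · rintro ⟨ι, hι⟩
    exact ⟨ι.range, ⟨MonoidHom.ofInjective hι⟩⟩

/-! ### Relations in the lamplighter group -/

namespace Lamplighter

/-- The generator of the lamp group sitting at the origin. -/
noncomputable def lamp : Lamplighter :=
  SemidirectProduct.inl (Multiplicative.ofAdd (Finsupp.single 0 1))

/-- The generator of the shifting copy of `ℤ`. -/
noncomputable def shift : Lamplighter :=
  SemidirectProduct.inr (Multiplicative.ofAdd 1)

theorem lampShift_single (k : Multiplicative ℤ) (i : ℤ) (c : ZMod 2) :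
    lampShift k (Multiplicative.ofAdd (Finsupp.single i c)) =
      Multiplicative.ofAdd (Finsupp.single (k.toAdd + i) c) :=
  Finsupp.domCongr_apply (Equiv.addLeft k.toAdd) (Finsupp.single i c) ▸
    Finsupp.equivMapDomain_single _ _ _

theorem lamp_mul_self : lamp * lamp = 1 := by
  rw [lamp, ← map_mul, ← ofAdd_add, ← Finsupp.single_add]
  have : (1 : ZMod 2) + 1 = 0 := rfl
  simp [this]

/-- The two products have lamps lit at `{0, N}` and at `{N, 2N}`, which differ at the origin. -/
theorem not_commute (N : ℕ) (hN : 0 < N) :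
    ¬ Commute (lamp * shift ^ N * lamp) (shift ^ N) := by
  intro h
  have h1 := congrArg (fun g : Lamplighter => g.left.toAdd 0) h.eq
  rw [shift, ← map_pow, ← ofAdd_nsmul] at h1
  simp [lamp, SemidirectProduct.mul_left, SemidirectProduct.mul_right, lampShift_single,
    Finsupp.single_apply] at h1
  omega

end Lamplighter

/-! ### Full groups of odometers contain no lamplighter group -/

section Odometer

variable {X : Type*} [TopologicalSpace X] {φ : X ≃ₜ X} {m : ℕ} {p : X → ZMod m}

theorem factor_zpow (hp : ∀ x, p (φ x) = p x + 1) (k : ℤ) (x : X) :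
    p ((φ ^ k) x) = p x + k := by
  induction k with
  | zero => simp
  | succ i ih =>
    rw [add_comm, zpow_add, Homeomorph.mul_apply, zpow_one, hp, ih]
    push_cast
    ring
  | pred i ih =>
    have h := hp ((φ ^ (-(i : ℤ) - 1)) x)
    rw [← Homeomorph.mul_apply, ← zpow_one_add, show (1 : ℤ) + (-(i : ℤ) - 1) = -i by ring, ih] at h
    push_cast at h ⊢
    linear_combination -h

/-- Pairs of a homeomorphism `ψ` whose orbit cocycle with respect to `φ` depends only on the factor
`p` and a permutation of the factor that is induced by `ψ`. -/
def levelSubmonoid (φ : X ≃ₜ X) (p : X → ZMod m) :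
    Submonoid ((X ≃ₜ X) × Equiv.Perm (ZMod m)) where
  carrier := {ψ | (∃ c : ZMod m → ℤ, ∀ x, ψ.1 x = (φ ^ c (p x)) x) ∧ ∀ x, p (ψ.1 x) = ψ.2 (p x)}
  mul_mem' := by
    rintro ⟨a, f⟩ ⟨b, g⟩ ⟨⟨c, hc⟩, hf⟩ ⟨⟨d, hd⟩, hg⟩
    refine ⟨⟨fun i => c (g i) + d i, fun x => ?_⟩, fun x => ?_⟩
    · dsimp only at *
      rw [zpow_add, Homeomorph.mul_apply, ← hd, ← hg, ← hc]
      rfl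
    · dsimp only at *
      rw [Prod.mk_mul_mk, Homeomorph.mul_apply, hf, hg]
      rfl
  one_mem' := ⟨⟨fun _ => 0, fun x => by simp⟩, fun x => rfl⟩

/-- Both elements preserve each level of `p` and act on it by a single power of `φ`. -/
theorem commute_of_mem_levelSubmonoid {a b : X ≃ₜ X} (ha : (a, 1) ∈ levelSubmonoid φ p)
    (hb : (b, 1) ∈ levelSubmonoid φ p) : Commute a b := by
  obtain ⟨⟨c, hc⟩, hf⟩ := ha
  obtain ⟨⟨d, hd⟩, hg⟩ := hb
  refine Homeomorph.ext fun x => ?_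
  dsimp only [Equiv.Perm.one_apply] at *
  rw [Homeomorph.mul_apply, Homeomorph.mul_apply, hc (b x), hg, hd (a x), hf, hc x, hd x,
    ← Homeomorph.mul_apply, ← Homeomorph.mul_apply, ← zpow_add, ← zpow_add, add_comm]

theorem exists_mem_levelSubmonoid [NeZero m] (hp : ∀ x, p (φ x) = p x + 1)
    (hs : Function.Surjective p) {a : X ≃ₜ X} {c : X → ℤ} (hc : ∀ x, a x = (φ ^ c x) x)
    (hcp : ∀ x y, p x = p y → c x = c y) : ∃ f, (a, f) ∈ levelSubmonoid φ p := by
  set d : ZMod m → ℤ := fun i => c (Function.surjInv hs i)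
  have hdc : ∀ x, d (p x) = c x := fun x => hcp _ _ (Function.surjInv_eq hs _)
  have hf : ∀ x, p (a x) = p x + d (p x) := fun x => by rw [hc, factor_zpow hp, hdc]
  -- Surjectivity of `a` descends to the level map, and finiteness of `ZMod m` makes that map a
  -- permutation.
  have hsurj : Function.Surjective fun i : ZMod m => i + (d i : ZMod m) := fun i => by
    obtain ⟨x, rfl⟩ := hs i
    refine ⟨p (a.symm x), ?_⟩
    dsimp only
    rw [← hf, a.apply_symm_apply]
  exact ⟨Equiv.ofBijective _ (Finite.injective_iff_bijective.1
    (Finite.injective_iff_surjective.2 hsurj)), ⟨d, fun x => by rw [hdc, hc]⟩, hf⟩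

/-- With `N` the order of the permutation induced by `a`, both `a ^ N` and its conjugate by the
involution `b` act trivially on the levels. -/
theorem exists_commute_of_factor [NeZero m] [Nonempty X] (hp : ∀ x, p (φ x) = p x + 1)
    {a b : X ≃ₜ X} {c d : X → ℤ} (hc : ∀ x, a x = (φ ^ c x) x) (hd : ∀ x, b x = (φ ^ d x) x)
    (hcp : ∀ x y, p x = p y → c x = c y) (hdp : ∀ x y, p x = p y → d x = d y)
    (hb : b * b = 1) : ∃ N > 0, Commute (b * a ^ N * b) (a ^ N) := by
  have hs : Function.Surjective p := fun i => by
    obtain ⟨x⟩ := ‹Nonempty X›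
    obtain ⟨k, hk⟩ := ZMod.intCast_surjective (i - p x)
    exact ⟨(φ ^ k) x, by rw [factor_zpow hp, hk]; ring⟩
  obtain ⟨f, hf⟩ := exists_mem_levelSubmonoid hp hs hc hcp
  obtain ⟨g, hg⟩ := exists_mem_levelSubmonoid hp hs hd hdp
  have hg2 : g * g = 1 := by
    refine Equiv.ext fun i => ?_
    obtain ⟨x, rfl⟩ := hs i
    have h := hg.2
    dsimp only at h
    rw [Equiv.Perm.mul_apply, ← h, ← h, ← Homeomorph.mul_apply, hb]
    rfl
  have hN := pow_mem hf (orderOf f)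
  rw [Prod.pow_mk, pow_orderOf_eq_one] at hN
  refine ⟨orderOf f, orderOf_pos f, commute_of_mem_levelSubmonoid ?_ hN⟩
  simpa [hg2] using mul_mem (mul_mem hg hN) hg

theorem IsOdometer.exists_factor [CompactSpace X] (h : IsOdometer φ) {Y : Type*}
    [TopologicalSpace Y] [DiscreteTopology Y] {c : X → Y} (hc : Continuous c) :
    ∃ m : ℕ, m ≠ 0 ∧ ∃ p : X → ZMod m, (∀ x, p (φ x) = p x + 1) ∧
      ∀ x y, p x = p y → c x = c y := by
  obtain ⟨m, hm, hlim, f, hf⟩ := h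
  have hmono : ∀ n k, n ≤ k → m n ∣ m k := fun n k hnk =>
    Nat.le_induction dvd_rfl (fun k _ ih => ih.trans (hm k)) k hnk
  have hne : ∀ n, m n ≠ 0 := fun n h0 => by
    obtain ⟨k, hk⟩ := (hlim.eventually_gt_atTop 0).exists_forall_of_atTop
    have := hmono n (max n k) (le_max_left _ _)
    rw [h0, zero_dvd_iff] at this
    exact (hk (max n k) (le_max_right _ _)).ne' this
  have hcont : ∀ n, Continuous fun x => (f x).1 n := fun n =>
    (continuous_apply n).comp (continuous_subtype_val.comp f.continuous)
  -- These closed sets of bad pairs decrease with `n`. If all were nonempty, a common point would be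
  -- two points with equal odometer coordinates but different values of `c`.
  set K : ℕ → Set (X × X) := fun n => {z | (f z.1).1 n = (f z.2).1 n ∧ c z.1 ≠ c z.2}
  have hKclosed : ∀ n, IsClosed (K n) := fun n => by
    refine IsClosed.inter ?_ ?_
    · exact isClosed_eq ((hcont n).comp continuous_fst) ((hcont n).comp continuous_snd)
    · exact (isClosed_discrete {w : Y × Y | w.1 ≠ w.2}).preimage (hc.prodMap hc)
  by_contra! hcon
  obtain ⟨z, hz⟩ := IsCompact.nonempty_iInter_of_sequence_nonempty_isCompact_isClosed K
    (fun n z hz => ⟨by rw [← (f z.1).2 n, ← (f z.2).2 n, hz.1], hz.2⟩)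
    (fun n => by
      obtain ⟨x, y, hxy, hne'⟩ := hcon (m n) (hne n) (fun x => (f x).1 n)
        (fun x => by rw [hf]; rfl)
      exact ⟨(x, y), hxy, hne'⟩)
    (hKclosed 0).isCompact hKclosed
  rw [Set.mem_iInter] at hz
  exact (hz 0).2 (congrArg c (f.injective (Subtype.ext (funext fun n => (hz n).1))))

theorem IsOdometer.not_containsLamplighter [CompactSpace X] [Nonempty X] (h : IsOdometer φ) :
    ¬ ContainsLamplighter (topFullGroup φ) := by
  rw [containsLamplighter_iff]
  rintro ⟨ι, hι⟩
  obtain ⟨c, hc, hca⟩ := (ι Lamplighter.shift).2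
  obtain ⟨d, hd, hdb⟩ := (ι Lamplighter.lamp).2
  obtain ⟨m, hm, p, hp, hcd⟩ := h.exists_factor (hc.prodMk hd)
  have : NeZero m := ⟨hm⟩
  obtain ⟨N, hN, hcomm⟩ := exists_commute_of_factor hp hca hdb
    (fun x y hxy => congrArg Prod.fst (hcd x y hxy))
    (fun x y hxy => congrArg Prod.snd (hcd x y hxy))
    (by rw [← Subgroup.coe_mul, ← map_mul, Lamplighter.lamp_mul_self, map_one, Subgroup.coe_one])
  refine Lamplighter.not_commute N hN (hι ?_)
  refine Subtype.ext ?_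
  simpa using hcomm.eq

end Odometer

/-! ### Periodicity of all clopen sets characterises odometers -/

section Periodic

variable {X : Type*} [TopologicalSpace X]

theorem zpow_add_apply (φ : X ≃ₜ X) (k l : ℤ) (x : X) : (φ ^ (k + l)) x = (φ ^ k) ((φ ^ l) x) := by
  rw [zpow_add, Homeomorph.mul_apply]

theorem zpow_one_add_apply (φ : X ≃ₜ X) (k : ℤ) (x : X) : (φ ^ (1 + k)) x = φ ((φ ^ k) x) := by
  rw [zpow_add_apply, zpow_one]

theorem zpow_mul_mem_iff {φ : X ≃ₜ X} {A : Set X} {N : ℤ} (hN : ∀ x, (φ ^ N) x ∈ A ↔ x ∈ A)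
    (q : ℤ) (x : X) : (φ ^ (N * q)) x ∈ A ↔ x ∈ A := by
  induction q generalizing x with
  | zero => simp
  | succ i ih => rw [mul_add, mul_one, zpow_add_apply, ih, hN]
  | pred i ih =>
    rw [← hN, ← zpow_add_apply, show N + N * (-i - 1) = N * -i by ring, ih]

/-- Two points have the same itinerary with respect to the sets `A 0, …, A n`. -/
def SameItinerary (φ : X ≃ₜ X) (A : ℕ → Set X) (n : ℕ) (x y : X) : Prop :=
  ∀ j ≤ n, ∀ k : ℤ, (φ ^ k) x ∈ A j ↔ (φ ^ k) y ∈ A j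

variable {φ : X ≃ₜ X} {A : ℕ → Set X} {n : ℕ} {x y z : X}

theorem SameItinerary.refl (x : X) : SameItinerary φ A n x x := fun _ _ _ => Iff.rfl

theorem SameItinerary.symm (h : SameItinerary φ A n x y) : SameItinerary φ A n y x :=
  fun j hj k => (h j hj k).symm

theorem SameItinerary.trans (h : SameItinerary φ A n x y) (h' : SameItinerary φ A n y z) :
    SameItinerary φ A n x z := fun j hj k => (h j hj k).trans (h' j hj k)

theorem SameItinerary.zpow (h : SameItinerary φ A n x y) (l : ℤ) :
    SameItinerary φ A n ((φ ^ l) x) ((φ ^ l) y) := fun j hj k => by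
  rw [← zpow_add_apply, ← zpow_add_apply]
  exact h j hj _

theorem SameItinerary.mono {k : ℕ} (hk : k ≤ n) (h : SameItinerary φ A n x y) :
    SameItinerary φ A k x y := fun j hj => h j (hj.trans hk)

/-- Periodicity leaves only finitely many clopen conditions: one period for each of finitely many
sets. -/
theorem isOpen_sameItinerary (hA : ∀ j, IsClopen (A j))
    (hper : ∀ j, ∃ N > (0 : ℤ), ∀ x, (φ ^ N) x ∈ A j ↔ x ∈ A j) (n : ℕ) (x : X) :
    IsOpen {y | SameItinerary φ A n x y} := by
  choose N hN hNA using hper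
  have hset : {y | SameItinerary φ A n x y} = ⋂ j ∈ Set.Iic n, ⋂ k ∈ Set.Ico 0 (N j),
      {y | (φ ^ k) x ∈ A j ↔ (φ ^ k) y ∈ A j} := by
    ext y
    simp only [Set.mem_ofPred_eq, Set.mem_iInter]
    refine ⟨fun h j hj k _ => h j hj k, fun h j hj k => ?_⟩
    have hmod : ∀ z, (φ ^ k) z ∈ A j ↔ (φ ^ (k % N j)) z ∈ A j := fun z => by
      conv_lhs => rw [← Int.mul_ediv_add_emod k (N j), zpow_add_apply, zpow_mul_mem_iff (hNA j)]
    rw [hmod x, hmod y]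
    exact h j hj _ ⟨Int.emod_nonneg _ (hN j).ne', Int.emod_lt_of_pos _ (hN j)⟩
  rw [hset]
  refine (Set.finite_Iic n).isOpen_biInter fun j _ => (Set.finite_Ico _ _).isOpen_biInter
    fun k _ => ?_
  have hk : IsClopen ((φ ^ k) ⁻¹' A j) := (hA j).preimage (φ ^ k).continuous
  by_cases hx : (φ ^ k) x ∈ A j
  · simp only [hx, true_iff]
    exact hk.isOpen
  · simp only [hx, false_iff]
    exact hk.compl.isOpen

/-- The times `d` form a subgroup of `ℤ`, nonzero because it contains the product of the periods. -/
theorem exists_nat_forall_sameItinerary_iff_dvd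
    (hper : ∀ j, ∃ N > (0 : ℤ), ∀ x, (φ ^ N) x ∈ A j ↔ x ∈ A j) (n : ℕ) (x : X) :
    ∃ m : ℕ, m ≠ 0 ∧ ∀ d : ℤ, SameItinerary φ A n x ((φ ^ d) x) ↔ (m : ℤ) ∣ d := by
  choose N hN hNA using hper
  set H : AddSubgroup ℤ :=
    { carrier := {d | SameItinerary φ A n x ((φ ^ d) x)}
      zero_mem' := by simpa using SameItinerary.refl x
      add_mem' := fun {a b} ha hb => by
        rw [Set.mem_ofPred_eq, zpow_add_apply]
        exact SameItinerary.trans ha (SameItinerary.zpow hb a)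
      neg_mem' := fun {a} ha => by
        have h := SameItinerary.zpow ha (-a)
        rw [← zpow_add_apply, neg_add_cancel, zpow_zero, Homeomorph.one_apply] at h
        exact h.symm }
  obtain ⟨a, ha⟩ := Int.subgroup_cyclic H
  have hmem : ∀ d : ℤ, SameItinerary φ A n x ((φ ^ d) x) ↔ (a.natAbs : ℤ) ∣ d := fun d => by
    rw [Int.natAbs_dvd, ← Int.mem_zmultiples_iff, AddSubgroup.zmultiples_eq_closure, ← ha]
    rfl
  refine ⟨a.natAbs, fun h0 => ?_, hmem⟩
  have hprod := (hmem (∏ j ∈ Finset.range (n + 1), N j)).1 fun j hj k => by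
    obtain ⟨q, hq⟩ := Finset.dvd_prod_of_mem N (Finset.mem_range_succ_iff.2 hj)
    rw [← zpow_add_apply, add_comm, zpow_add_apply, hq, zpow_mul_mem_iff (hNA j)]
  rw [h0, Nat.cast_zero, zero_dvd_iff] at hprod
  exact (Finset.prod_pos fun j _ => hN j).ne' hprod

end Periodic

theorem isOdometer_of_forall_isClopen_periodic {X : Type*} [TopologicalSpace X]
    [TopologicalSpace.MetrizableSpace X] [CompactSpace X] [TotallyDisconnectedSpace X]
    [PerfectSpace X] [Nonempty X] {φ : X ≃ₜ X} (hφ : IsMinimalHomeo φ)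
    (hper : ∀ A : Set X, IsClopen A → ∃ N > (0 : ℤ), ∀ x, (φ ^ N) x ∈ A ↔ x ∈ A) :
    IsOdometer φ := by
  obtain ⟨x₀⟩ := ‹Nonempty X›
  let _ := TopologicalSpace.metrizableSpaceMetric X
  have : Countable (TopologicalSpace.Clopens X) :=
    TopologicalSpace.Clopens.countable_iff_secondCountable.2 inferInstance
  obtain ⟨C, hC⟩ := exists_surjective_nat (TopologicalSpace.Clopens X)
  set A : ℕ → Set X := fun j => C j with hAdef
  have hA : ∀ j, IsClopen (A j) := fun j => (C j).isClopen
  have hper' := fun j => hper (A j) (hA j)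
  choose m hm0 hm using fun n => exists_nat_forall_sameItinerary_iff_dvd hper' n x₀
  have hdvd : ∀ n, m n ∣ m (n + 1) := fun n =>
    Int.natCast_dvd_natCast.1 ((hm n _).1 (((hm (n + 1) _).2 dvd_rfl).mono n.le_succ))
  have hmono : Monotone m := monotone_nat_of_le_succ fun n =>
    Nat.le_of_dvd (Nat.pos_of_ne_zero (hm0 _)) (hdvd n)
  -- The itinerary class of `x` is open, so the dense orbit of `x₀` meets it; the hitting time
  -- modulo `m n` is the `n`-th coordinate.
  have horb : ∀ n x, ∃ k : ℤ, SameItinerary φ A n x ((φ ^ k) x₀) := fun n x => by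
    obtain ⟨y, ⟨k, rfl⟩, hy⟩ := (hφ x₀).exists_mem_open
      (isOpen_sameItinerary hA hper' n x) ⟨x, SameItinerary.refl x⟩
    exact ⟨k, ‹_›⟩
  choose k hk using horb
  set p : (n : ℕ) → X → ZMod (m n) := fun n x => (k n x : ZMod (m n)) with hpdef
  have hpiff : ∀ n x (l : ℤ), p n x = l ↔ SameItinerary φ A n x ((φ ^ l) x₀) := fun n x l => by
    rw [hpdef, eq_comm, ZMod.intCast_eq_intCast_iff_dvd_sub, ← hm]
    refine ⟨fun h => ?_, fun h => ?_⟩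
    · have h' := h.zpow l
      rw [← zpow_add_apply, add_sub_cancel] at h'
      exact (hk n x).trans h'.symm
    · have h' := (h.symm.trans (hk n x)).zpow (-l)
      rwa [← zpow_add_apply, ← zpow_add_apply, neg_add_cancel, zpow_zero, Homeomorph.one_apply,
        neg_add_eq_sub] at h'
  have hpeq : ∀ n x y, p n x = p n y ↔ SameItinerary φ A n x y := fun n x y => by
    rw [hpiff]
    exact ⟨fun h => h.trans (hk n y).symm, fun h => h.trans (hk n y)⟩
  have hpφ : ∀ n x, p n (φ x) = p n x + 1 := fun n x => by
    have h : p n (φ x) = ((1 + k n x : ℤ) : ZMod (m n)) := (hpiff _ _ _).2 (by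
      simpa [zpow_one_add_apply] using (hk n x).zpow 1)
    rw [h]
    push_cast
    rw [add_comm]
  have hcast : ∀ n x, ZMod.castHom (hdvd n) (ZMod (m n)) (p (n + 1) x) = p n x := fun n x => by
    rw [map_intCast, eq_comm, hpiff]
    exact (hk (n + 1) x).mono n.le_succ
  have hcont : ∀ n, Continuous (p n) := fun n => by
    refine IsLocallyConstant.continuous ((IsLocallyConstant.iff_exists_open _).2 fun x => ?_)
    exact ⟨_, isOpen_sameItinerary hA hper' n x, SameItinerary.refl x,
      fun y hy => ((hpeq n x y).2 hy).symm⟩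
  have hsep : ∀ x y, (∀ n, p n x = p n y) → x = y := fun x y h => by
    by_contra hxy
    obtain ⟨U, hU, hxU, hyU⟩ := exists_isClopen_of_totally_separated hxy
    obtain ⟨j, hj⟩ := hC ⟨U, hU⟩
    have hAU : A j = U := by rw [hAdef]; simp [hj]
    have := (hpeq j x y).1 (h j) j le_rfl 0
    rw [zpow_zero, Homeomorph.one_apply, Homeomorph.one_apply, hAU] at this
    exact hyU (this.1 hxU)
  -- If `m` were bounded it would stabilise at some `m a`; then `p a` alone would separate points
  -- and `X` would be finite, against perfectness.
  have hlim : Filter.Tendsto m Filter.atTop Filter.atTop := by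
    refine Filter.tendsto_atTop_atTop_of_monotone hmono ?_
    by_contra! hb
    obtain ⟨b, hb⟩ := hb
    obtain ⟨_, ⟨a, rfl⟩, hamax⟩ := Set.Finite.exists_maximal
      ((Set.finite_Iio b).subset (Set.range_subset_iff.2 hb)) (Set.range_nonempty m)
    have hstab : ∀ n, a ≤ n → m n = m a := fun n hn =>
      le_antisymm (hamax ⟨n, rfl⟩ (hmono hn)) (hmono hn)
    have hinj : Function.Injective (p a) := fun x y hxy => hsep x y fun n => by
      have hmax : SameItinerary φ A (max a n) x y := by
        rw [← hpeq, hpdef, ZMod.intCast_eq_intCast_iff_dvd_sub, hstab _ (le_max_left _ _),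
          ← ZMod.intCast_eq_intCast_iff_dvd_sub]
        rw [← (hpiff a x _).2 ((hk (max a n) x).mono (le_max_left _ _)),
          ← (hpiff a y _).2 ((hk (max a n) y).mono (le_max_left _ _)), hxy]
      exact (hpeq _ _ _).2 (hmax.mono (le_max_right _ _))
    have : NeZero (m a) := ⟨hm0 a⟩
    have : Finite X := Finite.of_injective _ hinj
    exact Set.infinite_univ_iff.1 (infinite_of_mem_nhds x₀ Filter.univ_mem) |>.not_finite this
  set f : X → OdometerSpace m hdvd := fun x => ⟨fun n => p n x, fun n => hcast n x⟩
  have hfcont : Continuous f := Continuous.subtype_mk (continuous_pi hcont) _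
  have hfinj : Function.Injective f := fun x y hxy =>
    hsep x y fun n => congrFun (congrArg Subtype.val hxy) n
  have hfsurj : Function.Surjective f := fun z => by
    have hclosed : ∀ n, IsClosed {x | p n x = z.1 n} := fun n =>
      isClosed_eq (hcont n) continuous_const
    obtain ⟨x, hx⟩ := IsCompact.nonempty_iInter_of_sequence_nonempty_isCompact_isClosed
      (fun n => {x | p n x = z.1 n})
      (fun n x hx => by
        rw [Set.mem_ofPred_eq] at hx ⊢
        rw [← hcast, ← z.2, hx])
      (fun n => by
        obtain ⟨l, hl⟩ := ZMod.intCast_surjective (z.1 n)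
        exact ⟨(φ ^ l) x₀, by rw [Set.mem_ofPred_eq, ← hl, hpiff]; exact SameItinerary.refl _⟩)
      (hclosed 0).isCompact hclosed
    rw [Set.mem_iInter] at hx
    exact ⟨x, Subtype.ext (funext hx)⟩
  exact ⟨m, hdvd, hlim, hfcont.homeoOfEquivCompactToT2 (f := Equiv.ofBijective f ⟨hfinj, hfsurj⟩),
    fun x => Subtype.ext (funext fun n => hpφ n x)⟩

/-! ### Maps out of the lamplighter group and passage to the commutator subgroup -/

section Lift

variable {G : Type*} [Group G]

theorem map_lampShift_of_generator {f : Multiplicative (ℤ →₀ ZMod 2) →* G} {a : G}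
    (h : ∀ v, f (lampShift (Multiplicative.ofAdd 1) v) = a * f v * a⁻¹)
    (n : ℤ) (v : Multiplicative (ℤ →₀ ZMod 2)) :
    f (lampShift (Multiplicative.ofAdd n) v) = a ^ n * f v * (a ^ n)⁻¹ := by
  induction n generalizing v with
  | zero => simp
  | succ i ih =>
    rw [ofAdd_add, map_mul, MulAut.mul_apply, ih, h, zpow_add_one]
    group
  | pred i ih =>
    have h1 := h (lampShift (Multiplicative.ofAdd (-1)) v)
    rw [← MulAut.mul_apply, ← map_mul, ← ofAdd_add, add_neg_cancel, ofAdd_zero, map_one,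
      MulAut.one_apply] at h1
    rw [sub_eq_add_neg, ofAdd_add, map_mul, MulAut.mul_apply, ih, h1, zpow_add]
    group

/-- The homomorphism from the lamplighter group given by a homomorphism `f` on the lamps and an
element `a` whose conjugation action shifts the lamps. -/
noncomputable def Lamplighter.lift (f : Multiplicative (ℤ →₀ ZMod 2) →* G) (a : G)
    (h : ∀ v, f (lampShift (Multiplicative.ofAdd 1) v) = a * f v * a⁻¹) : Lamplighter →* G :=
  SemidirectProduct.lift f (zpowersHom G a) fun n =>
    MonoidHom.ext fun v => map_lampShift_of_generator h n.toAdd v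

theorem Lamplighter.lift_apply (f : Multiplicative (ℤ →₀ ZMod 2) →* G) (a : G)
    (h : ∀ v, f (lampShift (Multiplicative.ofAdd 1) v) = a * f v * a⁻¹) (l : Lamplighter) :
    Lamplighter.lift f a h l = f l.left * a ^ l.right.toAdd := rfl

/-- For a kernel element, `a ^ l.right` lies in the abelian image of the lamps, so conjugation by it
is trivial; but it shifts the lamp at the origin by `l.right`. -/
theorem Lamplighter.lift_injective {f : Multiplicative (ℤ →₀ ZMod 2) →* G} {a : G}
    (h : ∀ v, f (lampShift (Multiplicative.ofAdd 1) v) = a * f v * a⁻¹)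
    (hf : Function.Injective f) : Function.Injective (Lamplighter.lift f a h) := by
  refine (injective_iff_map_eq_one _).2 fun l hl => ?_
  rw [lift_apply] at hl
  have hright : l.right.toAdd = 0 := by
    have h1 := map_lampShift_of_generator h l.right.toAdd
      (Multiplicative.ofAdd (Finsupp.single 0 1))
    rw [eq_inv_of_mul_eq_one_right hl, ← map_inv, ← map_inv, ← map_mul, ← map_mul] at h1
    have h2 := hf h1
    rw [mul_right_comm, mul_inv_cancel, one_mul, lampShift_single] at h2
    have h3 := congrArg (fun v : Multiplicative (ℤ →₀ ZMod 2) => v.toAdd 0) h2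
    simpa [Finsupp.single_apply] using h3
  rw [hright, zpow_zero, mul_one] at hl
  exact SemidirectProduct.ext (hf (hl.trans (map_one f).symm)) hright

/-- The automorphism of the lamps induced by the reflection of `ℤ`. -/
noncomputable def lampReflect :
    Multiplicative (ℤ →₀ ZMod 2) ≃* Multiplicative (ℤ →₀ ZMod 2) :=
  AddEquiv.toMultiplicative (Finsupp.domCongr (Equiv.neg ℤ))

theorem lampReflect_single (i : ℤ) (c : ZMod 2) :
    lampReflect (Multiplicative.ofAdd (Finsupp.single i c)) =
      Multiplicative.ofAdd (Finsupp.single (-i) c) :=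
  Finsupp.domCongr_apply (Equiv.neg ℤ) (Finsupp.single i c) ▸ Finsupp.equivMapDomain_single _ _ _

/-- The endomorphism of the lamplighter group that reflects the lamps and inverts the shift. -/
noncomputable def Lamplighter.reflect : Lamplighter →* Lamplighter :=
  SemidirectProduct.map lampReflect.toMonoidHom invMonoidHom fun k =>
    MonoidHom.ext fun v => Multiplicative.toAdd.injective <| Finsupp.ext fun i => by
      change v.toAdd (-k.toAdd + -i) = v.toAdd (-(- -k.toAdd + i))
      congr 1
      ring

theorem Lamplighter.inr_conj_single (n i : ℤ) (c : ZMod 2) :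
    (SemidirectProduct.inr (Multiplicative.ofAdd n) : Lamplighter) *
      SemidirectProduct.inl (Multiplicative.ofAdd (Finsupp.single i c)) *
      (SemidirectProduct.inr (Multiplicative.ofAdd n))⁻¹ =
      SemidirectProduct.inl (Multiplicative.ofAdd (Finsupp.single (n + i) c)) := by
  rw [← map_inv, ← SemidirectProduct.inl_aut, lampShift_single]
  rfl

/-- On generators: lamps at `i` and `-i` are conjugate by the shift by `-2i`, so they have equal
images, whose product is trivial as lamps are involutions; the shift meets its own inverse. -/
theorem map_mul_map_reflect {H : Type*} [CommGroup H] (f : Lamplighter →* H) (l : Lamplighter) :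
    f l * f (Lamplighter.reflect l) = 1 := by
  suffices f * f.comp Lamplighter.reflect = 1 from DFunLike.congr_fun this l
  refine SemidirectProduct.hom_ext ?_ (MonoidHom.ext_mint ?_)
  · refine MonoidHom.toAdditiveRight.injective (Finsupp.addHom_ext fun i c => ?_)
    change f (SemidirectProduct.inl (Multiplicative.ofAdd (Finsupp.single i c))) *
      f (SemidirectProduct.inl (lampReflect (Multiplicative.ofAdd (Finsupp.single i c)))) = 1
    rw [lampReflect_single, show -i = -2 * i + i by ring, ← Lamplighter.inr_conj_single, map_mul,
      map_mul, map_inv, mul_right_comm _ (f _) (f _)⁻¹, mul_inv_cancel, one_mul, ← map_mul,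
      ← map_mul, ← ofAdd_add, ← Finsupp.single_add, CharTwo.add_self_eq_zero]
    simp
  · change f (SemidirectProduct.inr (Multiplicative.ofAdd 1)) *
      f (SemidirectProduct.map _ _ _ (SemidirectProduct.inr (Multiplicative.ofAdd 1))) = 1
    rw [SemidirectProduct.map_inr, invMonoidHom_apply, map_inv, map_inv, mul_inv_cancel]

/-- If a copy of the lamplighter group in `G` has a conjugate that commutes with it and meets it
trivially, then the commutator subgroup of `G` contains the lamplighter group. -/
theorem containsLamplighter_commutator {ι : Lamplighter →* G} (hι : Function.Injective ι) (s : G)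
    (hcomm : ∀ l l', Commute (ι l) (s * ι l' * s⁻¹))
    (hdisj : ∀ l l', ι l * (s * ι l' * s⁻¹) = 1 → ι l = 1) :
    ContainsLamplighter (commutator G) := by
  -- The commuting conjugate makes the product multiplicative; the reflection makes it vanish in the
  -- abelianization.
  set Θ : Lamplighter →* G :=
    { toFun := fun l => ι l * (s * ι (Lamplighter.reflect l) * s⁻¹)
      map_one' := by simp
      map_mul' := fun l l' => by
        have h := (hcomm l' (Lamplighter.reflect l)).eq
        calc ι (l * l') * (s * ι (Lamplighter.reflect (l * l')) * s⁻¹)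
            = ι l * (ι l' * (s * ι (Lamplighter.reflect l) * s⁻¹)) *
              (s * ι (Lamplighter.reflect l') * s⁻¹) := by
              rw [map_mul, map_mul, map_mul]
              group
          _ = _ := by
              rw [h]
              group }
  have hmem : ∀ l, Θ l ∈ commutator G := fun l => by
    rw [← Abelianization.ker_of, MonoidHom.mem_ker]
    have h := map_mul_map_reflect (Abelianization.of.comp ι) l
    change Abelianization.of (ι l * (s * ι (Lamplighter.reflect l) * s⁻¹)) = 1
    rw [map_mul, map_mul, map_mul, map_inv, mul_right_comm _ (Abelianization.of _) _,
      mul_inv_cancel, one_mul]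
    exact h
  refine containsLamplighter_iff.2 ⟨Θ.codRestrict _ hmem, (injective_iff_map_eq_one _).2
    fun l hl => ?_⟩
  exact hι ((hdisj _ _ (congrArg Subtype.val hl)).trans (map_one ι).symm)

end Lift

/-- A function with values in `ℤ/2` whose translates under a permutation satisfy a nontrivial
linear relation is periodic. -/
theorem exists_periodic_of_linearCombination_eq_zero {X : Type*} [TopologicalSpace X]
    {α : X ≃ₜ X} {f : X → ZMod 2} {v : ℤ →₀ ZMod 2} (hv : v ≠ 0)
    (h : Finsupp.linearCombination (ZMod 2) (fun (k : ℤ) x => f ((α ^ (-k)) x)) v = 0) :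
    ∃ N > (0 : ℤ), ∀ x, f ((α ^ N) x) = f x := by
  set F : ℤ → X → ZMod 2 := fun k x => f ((α ^ (-k)) x) with hF
  have hne : v.support.Nonempty := Finsupp.support_nonempty_iff.2 hv
  set K := v.support.max' hne
  set k₀ := v.support.min' hne
  set S := Submodule.span (ZMod 2) (F '' Set.Ico k₀ K)
  have hrel : ∀ d : ℤ, ∑ i ∈ v.support, v i • F (i + d) = 0 := fun d => by
    funext x
    have hx := congrFun h ((α ^ (-d)) x)
    rw [Finsupp.linearCombination_apply, Finsupp.sum, Finset.sum_apply] at hx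
    rw [Finset.sum_apply]
    refine Eq.trans ?_ hx
    refine Finset.sum_congr rfl fun i _ => ?_
    simp only [Pi.smul_apply, hF, neg_add, zpow_add_apply]
  -- The top coefficient of the relation expresses each translate through earlier ones, so all
  -- forward translates lie in the finite space `S` and two of them coincide.
  have hS : ∀ n : ℕ, F (k₀ + n) ∈ S := fun n => by
    induction n using Nat.strong_induction_on with
    | _ n ih =>
      rcases lt_or_ge (k₀ + (n : ℤ)) K with hlt | hge
      · exact Submodule.subset_span ⟨_, ⟨by omega, hlt⟩, rfl⟩
      · have hKmem : K ∈ v.support := Finset.max'_mem _ _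
        have h1 := hrel (k₀ + n - K)
        rw [← Finset.add_sum_erase _ _ hKmem, add_sub_cancel, add_eq_zero_iff_eq_neg] at h1
        refine (Submodule.smul_mem_iff S (Finsupp.mem_support_iff.1 hKmem)).1 ?_
        rw [h1]
        refine S.neg_mem (S.sum_mem fun i hi => S.smul_mem _ ?_)
        obtain ⟨hiK, hi⟩ := Finset.mem_erase.1 hi
        have hi1 : i < K := lt_of_le_of_ne (Finset.le_max' _ _ hi) hiK
        have hi0 : k₀ ≤ i := Finset.min'_le _ _ hi
        have h2 := ih (i + (k₀ + n - K) - k₀).toNat (by omega)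
        rwa [Int.toNat_of_nonneg (by omega), add_sub_cancel] at h2
  have : FiniteDimensional (ZMod 2) S :=
    FiniteDimensional.span_of_finite _ ((Set.finite_Ico k₀ K).image F)
  have : Finite S := Module.finite_of_finite (ZMod 2)
  obtain ⟨a, b, hab, heq⟩ :=
    Finite.exists_ne_map_eq_of_infinite fun n : ℕ => (⟨F (k₀ + n), hS n⟩ : S)
  have hshift : ∀ a b : ℕ, F (k₀ + a) = F (k₀ + b) → ∀ x, f ((α ^ ((b : ℤ) - a)) x) = f x :=
    fun a b heq x => by
      have hx := congrFun heq ((α ^ (k₀ + b)) x)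
      simp only [hF] at hx
      rw [← zpow_add_apply, ← zpow_add_apply, neg_add_cancel, zpow_zero, Homeomorph.one_apply] at hx
      rw [← hx]
      congr 3
      ring
  rcases hab.lt_or_gt with hlt | hlt
  · exact ⟨(b : ℤ) - a, by omega, hshift a b (congrArg Subtype.val heq)⟩
  · exact ⟨(a : ℤ) - b, by omega, hshift b a (congrArg Subtype.val heq).symm⟩

/-! ### Recurrence and aperiodicity in minimal systems -/

section Minimal

variable {X : Type*} [TopologicalSpace X] {φ : X ≃ₜ X}

theorem IsMinimalHomeo.inv (hφ : IsMinimalHomeo φ) : IsMinimalHomeo φ⁻¹ := fun x => by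
  refine (hφ x).mono ?_
  rintro _ ⟨n, rfl⟩
  exact ⟨-n, by rw [inv_zpow', neg_neg]⟩

theorem IsMinimalHomeo.exists_pos_zpow_mem [CompactSpace X] (hφ : IsMinimalHomeo φ) {U : Set X}
    (hU : IsOpen U) (hne : U.Nonempty) (x : X) : ∃ n : ℕ, 0 < n ∧ (φ ^ (n : ℤ)) x ∈ U := by
  obtain ⟨t, ht⟩ := isCompact_univ.elim_finite_subcover (fun k : ℤ => (φ ^ k) ⁻¹' U)
    (fun k => hU.preimage (φ ^ k).continuous) (fun y _ => by
      obtain ⟨_, ⟨k, rfl⟩, hk⟩ := (hφ y).exists_mem_open hU hne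
      exact Set.mem_iUnion.2 ⟨k, ‹_›⟩)
  -- Starting from time `M`, larger than every `|k|` in the finite cover, makes the hitting time
  -- positive.
  set M : ℤ := 1 + ∑ k ∈ t, |k|
  obtain ⟨k, hk, hkU⟩ := Set.mem_iUnion₂.1 (ht (Set.mem_univ ((φ ^ M) x)))
  have hle : |k| ≤ ∑ k ∈ t, |k| := Finset.single_le_sum (fun i _ => abs_nonneg i) hk
  have hpos : 0 < k + M := by
    have := neg_abs_le k
    omega
  rw [Set.mem_preimage, ← zpow_add_apply] at hkU
  refine ⟨(k + M).toNat, by omega, ?_⟩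
  rwa [Int.toNat_of_nonneg hpos.le]

theorem IsMinimalHomeo.zpow_apply_ne [T1Space X] [PerfectSpace X] (hφ : IsMinimalHomeo φ) {n : ℤ}
    (hn : 0 < n) (x : X) : (φ ^ n) x ≠ x := fun h => by
  have hmul : ∀ q : ℤ, (φ ^ (n * q)) x = x := fun q =>
    -- The auxiliary set is just `{x}`, written so that its invariance under `φ ^ n` is immediate.
    (zpow_mul_mem_iff (A := {y | (φ ^ n) y = y ∧ y = x}) (N := n)
      (fun y => ⟨fun hy => by
          have : (φ ^ n) y = y := (φ ^ n).injective hy.1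
          exact ⟨this, this ▸ hy.2⟩,
        fun hy => ⟨by rw [hy.1, hy.1], by rw [hy.1, hy.2]⟩⟩) q x).2 ⟨h, rfl⟩ |>.2
  have hfin : {y : X | ∃ k : ℤ, y = (φ ^ k) x}.Finite := by
    refine ((Set.finite_Ico 0 n).image fun k => (φ ^ k) x).subset ?_
    rintro _ ⟨k, rfl⟩
    refine ⟨k % n, ⟨Int.emod_nonneg _ hn.ne', Int.emod_lt_of_pos _ hn⟩, ?_⟩
    dsimp only
    conv_rhs => rw [← Int.emod_add_mul_ediv k n, zpow_add_apply, hmul]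
  have huniv : {y : X | ∃ k : ℤ, y = (φ ^ k) x} = Set.univ := by
    rw [← (hφ x).closure_eq, hfin.isClosed.closure_eq]
  rw [huniv] at hfin
  exact infinite_of_mem_nhds x Filter.univ_mem hfin

theorem IsMinimalHomeo.exists_isClopen_disjoint_translates [CompactSpace X] [T2Space X]
    [TotallyDisconnectedSpace X] [PerfectSpace X] [Nonempty X] (hφ : IsMinimalHomeo φ) (K : ℕ) :
    ∃ U : Set X, IsClopen U ∧ U.Nonempty ∧
      ∀ n : ℤ, 0 < n → n ≤ K → ∀ x ∈ U, (φ ^ n) x ∉ U := by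
  obtain ⟨x⟩ := ‹Nonempty X›
  have hsep : ∀ n ∈ Set.Ioc (0 : ℤ) K, ∃ V : Set X, IsClopen V ∧ x ∈ V ∧ (φ ^ n) x ∉ V :=
    fun n hn => exists_isClopen_of_totally_separated (hφ.zpow_apply_ne hn.1 x).symm
  choose! V hV hxV hnV using hsep
  refine ⟨⋂ n ∈ Set.Ioc (0 : ℤ) K, V n ∩ (φ ^ n) ⁻¹' (V n)ᶜ,
    (Set.finite_Ioc _ _).isClopen_biInter fun n hn =>
      (hV n hn).inter ((hV n hn).compl.preimage (φ ^ n).continuous),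
    ⟨x, Set.mem_iInter₂.2 fun n hn => ⟨hxV n hn, hnV n hn⟩⟩, fun n h0 hK y hy hy' => ?_⟩
  exact (Set.mem_iInter₂.1 hy n ⟨h0, hK⟩).2 (Set.mem_iInter₂.1 hy' n ⟨h0, hK⟩).1

end Minimal

/-! ### Swaps in the topological full group -/

section FullGroup

variable {X : Type*} [TopologicalSpace X] {φ : X ≃ₜ X}

theorem continuous_zpow_apply {c : X → ℤ} (hc : Continuous c) :
    Continuous fun x => (φ ^ c x) x := by
  have h : Continuous fun z : ℤ × X => (φ ^ z.1) z.2 :=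
    continuous_prod_of_discrete_left.2 fun k => (φ ^ k).continuous
  exact h.comp (hc.prodMk continuous_id)

/-- The element of the topological full group with a given invertible orbit cocycle. -/
def topFullGroup.mk (c d : X → ℤ) (hc : Continuous c) (hd : Continuous d)
    (hdc : ∀ x, (φ ^ d ((φ ^ c x) x)) ((φ ^ c x) x) = x)
    (hcd : ∀ x, (φ ^ c ((φ ^ d x) x)) ((φ ^ d x) x) = x) : topFullGroup φ :=
  ⟨{ toFun := fun x => (φ ^ c x) x
     invFun := fun x => (φ ^ d x) x
     left_inv := hdc
     right_inv := hcd
     continuous_toFun := continuous_zpow_apply hc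
     continuous_invFun := continuous_zpow_apply hd }, c, hc, fun _ => rfl⟩

/-- The orbit cocycle of a swap. -/
noncomputable def swapCocycle (φ : X ≃ₜ X) (n : ℤ) (E : Set X) (x : X) : ℤ :=
  open scoped Classical in if x ∈ E then n else if (φ ^ (-n)) x ∈ E then -n else 0

theorem continuous_swapCocycle {n : ℤ} {E : Set X} (hE : IsClopen E) :
    Continuous (swapCocycle φ n E) := by
  classical
  have h : ∀ {A : Set X}, IsClopen A → ∀ {f g : X → ℤ}, Continuous f → Continuous g →
      Continuous fun x => if x ∈ A then f x else g x := fun hA f g hf hg =>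
    hf.if (fun a ha => by
      have := hA.frontier_eq ▸ ha
      exact this.elim) hg
  exact h hE continuous_const
    (h (hE.preimage (φ ^ (-n)).continuous) continuous_const continuous_const)

theorem swapCocycle_zpow_apply {n : ℤ} {E : Set X} (hd : ∀ x ∈ E, (φ ^ n) x ∉ E) (x : X) :
    (φ ^ swapCocycle φ n E ((φ ^ swapCocycle φ n E x) x)) ((φ ^ swapCocycle φ n E x) x) = x := by
  by_cases h1 : x ∈ E
  · have h2 := hd x h1
    simp [swapCocycle, h1, h2]
  · by_cases h2 : (φ ^ (-n)) x ∈ E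
    · have h3 : swapCocycle φ n E x = -n := by simp only [swapCocycle, h1, h2, if_true, if_false]
      rw [h3]
      simp only [swapCocycle, h2, if_true]
      simp
    · have h3 : swapCocycle φ n E x = 0 := by simp only [swapCocycle, h1, h2, if_false]
      simp [h3]

/-- The involution that exchanges `E` with its disjoint translate under `φ ^ n`. -/
noncomputable def topFullGroup.swap (n : ℤ) (E : Set X) (hE : IsClopen E)
    (hd : ∀ x ∈ E, (φ ^ n) x ∉ E) : topFullGroup φ :=
  topFullGroup.mk (swapCocycle φ n E) (swapCocycle φ n E) (continuous_swapCocycle hE)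
    (continuous_swapCocycle hE) (swapCocycle_zpow_apply hd) (swapCocycle_zpow_apply hd)

namespace topFullGroup

variable {n : ℤ} {E : Set X} {hE : IsClopen E} {hd : ∀ x ∈ E, (φ ^ n) x ∉ E}

theorem swap_apply_of_mem {x : X} (hx : x ∈ E) : (swap n E hE hd).1 x = (φ ^ n) x := by
  change (φ ^ swapCocycle φ n E x) x = _
  simp only [swapCocycle, hx, if_true]

theorem swap_apply_zpow_of_mem {x : X} (hx : x ∈ E) : (swap n E hE hd).1 ((φ ^ n) x) = x := by
  have h1 := hd x hx
  have h2 : (φ ^ (-n)) ((φ ^ n) x) = x := by simp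
  have h3 : swapCocycle φ n E ((φ ^ n) x) = -n := by
    simp only [swapCocycle, h1, h2, hx, if_true, if_false]
  change (φ ^ swapCocycle φ n E _) _ = _
  rw [h3, h2]

theorem swap_apply_of_notMem {x : X} (hx : x ∉ E) (hx' : ∀ y ∈ E, (φ ^ n) y ≠ x) :
    (swap n E hE hd).1 x = x := by
  have h2 : (φ ^ (-n)) x ∉ E := fun h => hx' _ h (by simp)
  have h3 : swapCocycle φ n E x = 0 := by simp only [swapCocycle, hx, h2, if_false]
  change (φ ^ swapCocycle φ n E x) x = _
  rw [h3, zpow_zero, Homeomorph.one_apply]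

/-- The pairs `{y, (φ ^ n) y}` with `y ∈ U` are disjoint and preserved by every swap, so composing
swaps adds indicators modulo 2. -/
theorem swap_mul_swap {F G U : Set X} {hF : IsClopen F} {hdF : ∀ x ∈ F, (φ ^ n) x ∉ F}
    {hG : IsClopen G} {hdG : ∀ x ∈ G, (φ ^ n) x ∉ G} (hU : ∀ x ∈ U, (φ ^ n) x ∉ U)
    (hEU : E ⊆ U) (hFU : F ⊆ U) (h : ∀ x, x ∈ G ↔ (x ∈ E ↔ x ∉ F)) :
    swap n E hE hd * swap n F hF hdF = swap n G hG hdG := by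
  refine Subtype.ext (Homeomorph.ext fun x => ?_)
  rw [Subgroup.coe_mul, Homeomorph.mul_apply]
  have hGU : G ⊆ U := fun x hx => by
    by_cases hxE : x ∈ E
    · exact hEU hxE
    · exact hFU (not_not.1 fun hxF => hxE (((h x).1 hx).2 hxF))
  by_cases hx : ∃ y ∈ U, (φ ^ n) y = x
  · obtain ⟨y, hy, rfl⟩ := hx
    have hnot : ∀ {D : Set X}, D ⊆ U → (φ ^ n) y ∉ D := fun hD hyD => hU y hy (hD hyD)
    have hinj : ∀ {D : Set X}, y ∉ D → ∀ z ∈ D, (φ ^ n) z ≠ (φ ^ n) y := fun hyD z hz hzy =>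
      hyD ((φ ^ n).injective hzy ▸ hz)
    have htrans : ∀ {D : Set X}, D ⊆ U → ∀ z ∈ D, (φ ^ n) z ≠ y := fun hD z hz hzy =>
      hU z (hD hz) (hzy ▸ hy)
    by_cases hyE : y ∈ E <;> by_cases hyF : y ∈ F
    · have hyG : y ∉ G := fun hyG => ((h y).1 hyG).1 hyE hyF
      rw [swap_apply_zpow_of_mem hyF, swap_apply_of_mem hyE,
        swap_apply_of_notMem (hnot hGU) (hinj hyG)]
    · have hyG : y ∈ G := (h y).2 (by tauto)
      rw [swap_apply_of_notMem (hnot hFU) (hinj hyF), swap_apply_zpow_of_mem hyE,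
        swap_apply_zpow_of_mem hyG]
    · have hyG : y ∈ G := (h y).2 (by tauto)
      rw [swap_apply_zpow_of_mem hyF, swap_apply_of_notMem hyE (htrans hEU),
        swap_apply_zpow_of_mem hyG]
    · have hyG : y ∉ G := fun hyG => by
        have := (h y).1 hyG
        tauto
      rw [swap_apply_of_notMem (hnot hFU) (hinj hyF), swap_apply_of_notMem (hnot hEU) (hinj hyE),
        swap_apply_of_notMem (hnot hGU) (hinj hyG)]
  · have htrans : ∀ {D : Set X}, D ⊆ U → ∀ z ∈ D, (φ ^ n) z ≠ x := fun hD z hz hzx =>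
      hx ⟨z, hD hz, hzx⟩
    by_cases hxE : x ∈ E <;> by_cases hxF : x ∈ F
    · have hxG : x ∉ G := fun hxG => ((h x).1 hxG).1 hxE hxF
      rw [swap_apply_of_mem hxF, swap_apply_zpow_of_mem hxE, swap_apply_of_notMem hxG (htrans hGU)]
    · have hxG : x ∈ G := (h x).2 (by tauto)
      rw [swap_apply_of_notMem hxF (htrans hFU), swap_apply_of_mem hxE, swap_apply_of_mem hxG]
    · have hxG : x ∈ G := (h x).2 (by tauto)
      have hnotE : (φ ^ n) x ∉ E := fun hE' => hU x (hFU hxF) (hEU hE')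
      rw [swap_apply_of_mem hxF, swap_apply_of_mem hxG, swap_apply_of_notMem hnotE
        fun z hz hzx => hxE ((φ ^ n).injective hzx ▸ hz)]
    · have hxG : x ∉ G := fun hxG => by
        have := (h x).1 hxG
        tauto
      rw [swap_apply_of_notMem hxF (htrans hFU), swap_apply_of_notMem hxE (htrans hEU),
        swap_apply_of_notMem hxG (htrans hGU)]

/-- `g` carries each swapped pair over `E` to a swapped pair over `F`, as it commutes with `φ ^ n`
on `E`. -/
theorem mul_swap_mul_inv {F : Set X} {hF : IsClopen F} {hdF : ∀ x ∈ F, (φ ^ n) x ∉ F}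
    (g : topFullGroup φ) (hg : ∀ x ∈ E, g.1 ((φ ^ n) x) = (φ ^ n) (g.1 x))
    (hEF : ∀ x, g.1 x ∈ F ↔ x ∈ E) :
    swap n F hF hdF = g * swap n E hE hd * g⁻¹ := by
  rw [eq_mul_inv_iff_mul_eq]
  refine Subtype.ext (Homeomorph.ext fun x => ?_)
  rw [Subgroup.coe_mul, Homeomorph.mul_apply, Subgroup.coe_mul, Homeomorph.mul_apply]
  by_cases hxE : x ∈ E
  · rw [swap_apply_of_mem ((hEF x).2 hxE), swap_apply_of_mem hxE, hg x hxE]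
  by_cases hx : ∃ y ∈ E, (φ ^ n) y = x
  · obtain ⟨y, hy, rfl⟩ := hx
    rw [swap_apply_zpow_of_mem hy, hg y hy, swap_apply_zpow_of_mem ((hEF y).2 hy)]
  · rw [swap_apply_of_notMem hxE fun y hy hyx => hx ⟨y, hy, hyx⟩,
      swap_apply_of_notMem (fun h => hxE ((hEF x).1 h))]
    intro z hz hzx
    obtain ⟨y, rfl⟩ := g.1.surjective z
    have hy := (hEF y).1 hz
    exact hx ⟨y, hy, g.1.injective (by rw [hg y hy, hzx])⟩

end topFullGroup

end FullGroup

/-! ### The first return map -/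

section FirstReturn

variable {X : Type*} [TopologicalSpace X] {φ : X ≃ₜ X} {U : Set X}

open scoped Classical in
/-- The first return time to `U`. -/
noncomputable def returnTime (hr : ∀ x, ∃ n : ℕ, 0 < n ∧ (φ ^ (n : ℤ)) x ∈ U) (x : X) : ℕ :=
  Nat.find (hr x)

variable {hr : ∀ x, ∃ n : ℕ, 0 < n ∧ (φ ^ (n : ℤ)) x ∈ U}

theorem returnTime_pos (x : X) : 0 < returnTime hr x := by
  classical exact (Nat.find_spec (hr x)).1

theorem zpow_returnTime_mem (x : X) : (φ ^ (returnTime hr x : ℤ)) x ∈ U := by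
  classical exact (Nat.find_spec (hr x)).2

theorem returnTime_eq_iff {x : X} {n : ℕ} : returnTime hr x = n ↔
    (0 < n ∧ (φ ^ (n : ℤ)) x ∈ U) ∧ ∀ j < n, ¬ (0 < j ∧ (φ ^ (j : ℤ)) x ∈ U) := by
  classical exact Nat.find_eq_iff _

theorem continuous_returnTime (hU : IsClopen U) : Continuous (returnTime hr) := by
  refine IsLocallyConstant.continuous ((IsLocallyConstant.iff_exists_open _).2 fun x => ?_)
  have hpre : ∀ j : ℕ, IsClopen ((φ ^ (j : ℤ)) ⁻¹' U) := fun j =>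
    hU.preimage (φ ^ (j : ℤ)).continuous
  refine ⟨(φ ^ (returnTime hr x : ℤ)) ⁻¹' U ∩ ⋂ j ∈ Set.Ioo 0 (returnTime hr x),
    ((φ ^ (j : ℤ)) ⁻¹' U)ᶜ, (hpre _).isOpen.inter ((Set.finite_Ioo _ _).isOpen_biInter
      fun j _ => (hpre j).compl.isOpen), ⟨zpow_returnTime_mem x, ?_⟩, fun y hy => ?_⟩
  · refine Set.mem_iInter₂.2 fun j hj hjU => ?_
    exact (returnTime_eq_iff.1 (rfl : returnTime hr x = _)).2 j hj.2 ⟨hj.1, hjU⟩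
  · exact returnTime_eq_iff.2 ⟨⟨returnTime_pos x, hy.1⟩, fun j hj hjU =>
      Set.mem_iInter₂.1 hy.2 j ⟨hjU.1, hj⟩ hjU.2⟩

/-- Read backwards, a first return is a first return for the inverse. Keeping `ψ` abstract allows
use in both directions, which inverts the first return map. -/
theorem returnTime_zpow_returnTime {ψ : X ≃ₜ X} (hψ : ∀ k : ℤ, ψ ^ k = φ ^ (-k))
    {hr' : ∀ x, ∃ n : ℕ, 0 < n ∧ (ψ ^ (n : ℤ)) x ∈ U} {x : X} (hx : x ∈ U) :
    returnTime hr' ((φ ^ (returnTime hr x : ℤ)) x) = returnTime hr x := by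
  refine returnTime_eq_iff.2 ⟨⟨returnTime_pos x, ?_⟩, fun j hj hjU => ?_⟩
  · rwa [hψ, ← zpow_add_apply, neg_add_cancel, zpow_zero, Homeomorph.one_apply]
  · refine (returnTime_eq_iff.1 (rfl : returnTime hr x = _)).2 (returnTime hr x - j) (by omega)
      ⟨by omega, ?_⟩
    have h := hjU.2
    rw [hψ, ← zpow_add_apply] at h
    rwa [Nat.cast_sub hj.le, sub_eq_neg_add]

theorem exists_firstReturn [CompactSpace X] (hφ : IsMinimalHomeo φ) (hU : IsClopen U)
    (hne : U.Nonempty) : ∃ α : topFullGroup φ, ∃ r : X → ℕ, Continuous r ∧ (∀ x, 0 < r x) ∧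
      (∀ x ∈ U, α.1 x = (φ ^ (r x : ℤ)) x ∧ α.1 x ∈ U) ∧ ∀ x ∉ U, α.1 x = x := by
  classical
  have hr := hφ.exists_pos_zpow_mem hU.isOpen hne
  have hr' := hφ.inv.exists_pos_zpow_mem hU.isOpen hne
  have hinv : ∀ k : ℤ, φ⁻¹ ^ k = φ ^ (-k) := fun k => inv_zpow' φ k
  have hinv' : ∀ k : ℤ, φ ^ k = φ⁻¹ ^ (-k) := fun k => by rw [hinv, neg_neg]
  have hite : ∀ {f : X → ℤ}, Continuous f → Continuous fun x => if x ∈ U then f x else 0 :=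
    fun hf => hf.if (fun a ha => by
      have := hU.frontier_eq ▸ ha
      exact this.elim) continuous_const
  have hcast : Continuous (Nat.cast : ℕ → ℤ) := continuous_of_discreteTopology
  set c : X → ℤ := fun x => if x ∈ U then (returnTime hr x : ℤ) else 0
  set d : X → ℤ := fun x => if x ∈ U then -(returnTime hr' x : ℤ) else 0
  have hcU : ∀ x ∈ U, c x = returnTime hr x := fun x hx => if_pos hx
  have hdU : ∀ x ∈ U, d x = -returnTime hr' x := fun x hx => if_pos hx
  have hcU' : ∀ x ∉ U, c x = 0 := fun x hx => if_neg hx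
  have hdU' : ∀ x ∉ U, d x = 0 := fun x hx => if_neg hx
  refine ⟨topFullGroup.mk c d (hite (hcast.comp (continuous_returnTime hU)))
    (hite (hcast.comp (continuous_returnTime hU)).neg) (fun x => ?_) (fun x => ?_),
    returnTime hr, continuous_returnTime hU, returnTime_pos, fun x hx => ?_, fun x hx => ?_⟩
  · by_cases hx : x ∈ U
    · rw [hcU x hx, hdU _ (zpow_returnTime_mem x), returnTime_zpow_returnTime hinv hx,
        ← zpow_add_apply, neg_add_cancel, zpow_zero, Homeomorph.one_apply]
    · simp [hcU' x hx, hdU' x hx]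
  · by_cases hx : x ∈ U
    · rw [hdU x hx, ← hinv, hcU _ (zpow_returnTime_mem x), returnTime_zpow_returnTime hinv' hx,
        hinv, ← zpow_add_apply, add_neg_cancel, zpow_zero, Homeomorph.one_apply]
    · simp [hcU' x hx, hdU' x hx]
  · have h : (φ ^ c x) x = (φ ^ (returnTime hr x : ℤ)) x :=
      congrArg (fun k : ℤ => (φ ^ k) x) (hcU x hx)
    change (φ ^ c x) x = _ ∧ (φ ^ c x) x ∈ U
    exact ⟨h, h ▸ zpow_returnTime_mem x⟩
  · exact (congrArg (fun k : ℤ => (φ ^ k) x) (hcU' x hx)).trans (by simp)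

end FirstReturn

/-! ### From periodicity of the return map to periodicity of `φ` -/

section Periodicity

variable {X : Type*} [TopologicalSpace X] {φ : X ≃ₜ X} {U : Set X} {α : X ≃ₜ X}

theorem zpow_mem_iff_of_forall (hmem : ∀ x ∈ U, α x ∈ U) (hfix : ∀ x ∉ U, α x = x) (k : ℤ)
    (x : X) : (α ^ k) x ∈ U ↔ x ∈ U := by
  rw [← one_mul k]
  refine zpow_mul_mem_iff (fun y => ?_) k x
  rw [zpow_one]
  exact ⟨fun h => by_contra fun hy => hy (hfix y hy ▸ h), hmem y⟩

theorem exists_common_period [CompactSpace X] (hU : IsClopen U)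
    (h : ∀ B ⊆ U, IsClopen B → ∃ N > (0 : ℤ), ∀ x, (α ^ N) x ∈ B ↔ x ∈ B)
    {Y : Type*} [TopologicalSpace Y] [DiscreteTopology Y] {f : X → Y} (hf : Continuous f) :
    ∃ N > (0 : ℤ), ∀ x ∈ U, f ((α ^ N) x) = f x := by
  choose N hN hNB using fun y => h (U ∩ f ⁻¹' {y}) Set.inter_subset_left
    (hU.inter ((isClopen_discrete {y}).preimage hf))
  have hfin : (Set.range f).Finite := (isCompact_range hf).finite_of_discrete
  refine ⟨∏ y ∈ hfin.toFinset, N y, Finset.prod_pos fun y _ => hN y, fun x hx => ?_⟩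
  obtain ⟨q, hq⟩ := Finset.dvd_prod_of_mem N (hfin.mem_toFinset.2 ⟨x, rfl⟩)
  rw [hq]
  exact ((zpow_mul_mem_iff (hNB (f x)) q x).2 ⟨hx, rfl⟩).2

/-- If all clopen subsets of `U` are periodic for the first return map, then all clopen sets are
periodic. -/
theorem exists_period_of_firstReturn [CompactSpace X] (hU : IsClopen U) {r : X → ℕ}
    (hr : Continuous r) (hr0 : ∀ x, 0 < r x)
    (hα : ∀ x ∈ U, α x = (φ ^ (r x : ℤ)) x ∧ α x ∈ U) (hfix : ∀ x ∉ U, α x = x)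
    (hsweep : ∀ y, ∃ j : ℕ, ∃ x ∈ U, (φ ^ (j : ℤ)) x = y)
    (h : ∀ B ⊆ U, IsClopen B → ∃ N > (0 : ℤ), ∀ x, (α ^ N) x ∈ B ↔ x ∈ B)
    {A : Set X} (hA : IsClopen A) : ∃ M > (0 : ℤ), ∀ x, (φ ^ M) x ∈ A ↔ x ∈ A := by
  classical
  obtain ⟨R, hR⟩ := ((isCompact_range hr).finite_of_discrete).bddAbove
  have hrR : ∀ x, r x ≤ R := fun x => hR ⟨x, rfl⟩
  have hmemU := zpow_mem_iff_of_forall (fun x hx => (hα x hx).2) hfix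
  -- `N` is a common period of the return time and of the record of visits to `A` at all times below
  -- the bound `R`.
  obtain ⟨N, hN, hNf⟩ := exists_common_period (Y := ℕ × (Fin R → Bool)) hU h
    (f := fun x => (r x, fun j => decide ((φ ^ (j : ℤ)) x ∈ A)))
    (hr.prodMk (continuous_pi fun j => (continuous_bool_rng true).2 (by
      convert hA.preimage (φ ^ (j : ℤ)).continuous using 1
      ext x
      simp)))
  -- Below the return time this is read off the record; beyond it, pass to `α x` and use induction.
  have hshift : ∀ j : ℕ, ∀ x ∈ U, (φ ^ (j : ℤ)) ((α ^ N) x) ∈ A ↔ (φ ^ (j : ℤ)) x ∈ A := by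
    intro j
    induction j using Nat.strong_induction_on with
    | _ j ih =>
      intro x hx
      have hxN := (hmemU N x).2 hx
      have hrx : r ((α ^ N) x) = r x := congrArg Prod.fst (hNf x hx)
      rcases lt_or_ge j (r x) with hlt | hge
      · have h1 := congrFun (congrArg Prod.snd (hNf x hx)) ⟨j, hlt.trans_le (hrR x)⟩
        simpa using h1
      · have hj : ∀ z ∈ U, r z = r x → (φ ^ (j : ℤ)) z = (φ ^ ((j - r x : ℕ) : ℤ)) (α z) :=
          fun z hz hrz => by
            rw [(hα z hz).1, hrz, ← zpow_add_apply, Nat.cast_sub hge, sub_add_cancel]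
        rw [hj x hx rfl, hj _ hxN hrx, ← ih _ (by have := hr0 x; omega) _ (hα x hx).2]
        rw [← zpow_one_add_apply α N x, add_comm, zpow_add_apply, zpow_one]
  have htime : ∀ k : ℕ, ∀ x ∈ U, ∃ s : ℕ, k ≤ s ∧ s ≤ k * R ∧
      (α ^ (k : ℤ)) x = (φ ^ (s : ℤ)) x := by
    intro k x hx
    induction k with
    | zero => exact ⟨0, le_rfl, by simp, by simp⟩
    | succ k ih =>
      obtain ⟨s, hks, hsk, hs⟩ := ih
      have hxk := (hmemU k x).2 hx
      refine ⟨r ((α ^ (k : ℤ)) x) + s, by have := hr0 ((α ^ (k : ℤ)) x); omega, ?_, ?_⟩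
      · have := hrR ((α ^ (k : ℤ)) x)
        rw [Nat.succ_mul]
        omega
      · rw [Nat.cast_succ, add_comm, zpow_one_add_apply, (hα _ hxk).1, hs, ← zpow_add_apply,
          Nat.cast_add]
  lift N to ℕ using hN.le
  -- The duration `s` of `N` returns varies with `x`, but `0 < s ≤ N * R`, so the factorial is a
  -- multiple of all of them.
  refine ⟨((N * R).factorial : ℤ), by positivity, fun y => ?_⟩
  obtain ⟨j, x, hx, rfl⟩ := hsweep y
  obtain ⟨s, hNs, hsN, hs⟩ := htime N x hx
  obtain ⟨q, hq⟩ := Nat.dvd_factorial (by omega : 0 < s) hsN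
  have hiter : ∀ q : ℕ, ∀ j : ℕ, (φ ^ ((s * q : ℕ) : ℤ)) ((φ ^ (j : ℤ)) x) ∈ A ↔
      (φ ^ (j : ℤ)) x ∈ A := by
    intro q
    induction q with
    | zero => simp
    | succ q ih =>
      intro j
      have h1 : (φ ^ ((s + j : ℕ) : ℤ)) x = (φ ^ (j : ℤ)) ((φ ^ (s : ℤ)) x) := by
        rw [← zpow_add_apply, Nat.cast_add, add_comm]
      have h2 : (φ ^ ((s * (q + 1) : ℕ) : ℤ)) ((φ ^ (j : ℤ)) x) =
          (φ ^ ((s * q : ℕ) : ℤ)) ((φ ^ ((s + j : ℕ) : ℤ)) x) := by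
        rw [← zpow_add_apply, ← zpow_add_apply]
        push_cast
        ring_nf
      rw [h2, ih, h1, ← hs, hshift j x hx]
  rw [hq]
  exact hiter q j

end Periodicity

/-! ### Building the lamplighter group from an aperiodic clopen set -/

section Lamps

variable {X : Type*} [TopologicalSpace X] {φ : X ≃ₜ X}

open scoped Classical in
/-- The sum over `v` of the translates under `α` of the indicator function of `B`. -/
noncomputable def lampFun (α : X ≃ₜ X) (B : Set X) : (ℤ →₀ ZMod 2) →ₗ[ZMod 2] X → ZMod 2 :=
  Finsupp.linearCombination (ZMod 2) fun (k : ℤ) x => if (α ^ (-k)) x ∈ B then 1 else 0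

theorem lampFun_single_apply (α : X ≃ₜ X) (B : Set X) (k : ℤ) (c : ZMod 2) (x : X)
    [Decidable ((α ^ (-k)) x ∈ B)] :
    lampFun α B (Finsupp.single k c) x = if (α ^ (-k)) x ∈ B then c else 0 := by
  rw [lampFun, Finsupp.linearCombination_single, Pi.smul_apply, smul_eq_mul]
  split_ifs <;> simp

theorem continuous_lampFun (α : X ≃ₜ X) {B : Set X} (hB : IsClopen B) (v : ℤ →₀ ZMod 2) :
    Continuous (lampFun α B v) := by
  classical
  induction v using Finsupp.induction_linear with
  | zero => rw [map_zero]; exact continuous_const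
  | add v w hv hw => rw [map_add]; exact hv.add hw
  | single k c =>
    have h : IsClopen ((α ^ (-k)) ⁻¹' B) := hB.preimage (α ^ (-k)).continuous
    have h1 : lampFun α B (Finsupp.single k c) =
        fun x => if x ∈ (α ^ (-k)) ⁻¹' B then c else 0 :=
      funext fun x => lampFun_single_apply α B k c x
    rw [h1]
    exact continuous_const.if (fun a ha => by
      have := h.frontier_eq ▸ ha
      exact this.elim) continuous_const

theorem lampFun_eq_zero {α : X ≃ₜ X} {B U : Set X} (hBU : B ⊆ U)
    (hαU : ∀ (k : ℤ) x, (α ^ k) x ∈ U ↔ x ∈ U) (v : ℤ →₀ ZMod 2) {x : X} (hx : x ∉ U) :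
    lampFun α B v x = 0 := by
  classical
  induction v using Finsupp.induction_linear with
  | zero => rw [map_zero]; rfl
  | add v w hv hw => rw [map_add, Pi.add_apply, hv, hw, add_zero]
  | single k c => rw [lampFun_single_apply, if_neg fun h => hx ((hαU _ x).1 (hBU h))]

theorem lampFun_lampShift (α : X ≃ₜ X) (B : Set X) (v : Multiplicative (ℤ →₀ ZMod 2)) (x : X) :
    lampFun α B (lampShift (Multiplicative.ofAdd 1) v).toAdd (α x) = lampFun α B v.toAdd x := by
  classical
  induction v using Multiplicative.rec with | _ v
  induction v using Finsupp.induction_linear with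
  | zero => rw [ofAdd_zero, map_one, toAdd_one, map_zero]; rfl
  | add v w hv hw =>
    rw [ofAdd_add, map_mul, toAdd_mul, toAdd_mul, map_add, map_add, Pi.add_apply, Pi.add_apply, hv,
      hw]
  | single k c =>
    have h : (α ^ (-(1 + k))) (α x) = (α ^ (-k)) x := by
      rw [neg_add_rev, zpow_add_apply, zpow_neg_one]
      congr 1
      exact α.symm_apply_apply x
    rw [Lamplighter.lampShift_single, toAdd_ofAdd, toAdd_ofAdd, toAdd_ofAdd, lampFun_single_apply,
      lampFun_single_apply, h]

variable {U B : Set X} {α : topFullGroup φ}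

theorem isClopen_lampFun_ne_zero (α : X ≃ₜ X) (hB : IsClopen B) (v : ℤ →₀ ZMod 2) :
    IsClopen {x | lampFun α B v x ≠ 0} :=
  (isClopen_discrete {0}ᶜ).preimage (continuous_lampFun α hB v)

theorem lampFun_ne_zero_subset {α : X ≃ₜ X} (hBU : B ⊆ U)
    (hαU : ∀ (k : ℤ) x, (α ^ k) x ∈ U ↔ x ∈ U) (v : ℤ →₀ ZMod 2) :
    {x | lampFun α B v x ≠ 0} ⊆ U :=
  fun _ hx => not_not.1 fun h => hx (lampFun_eq_zero hBU hαU v h)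

/-- The involutions exchanging a sum of translates of `B` with its image under `φ`. -/
noncomputable def lampHom (hU : ∀ x ∈ U, (φ ^ (1 : ℤ)) x ∉ U) (hB : IsClopen B) (hBU : B ⊆ U)
    (hαU : ∀ (k : ℤ) x, (α.1 ^ k) x ∈ U ↔ x ∈ U) :
    Multiplicative (ℤ →₀ ZMod 2) →* topFullGroup φ :=
  MonoidHom.mk' (fun v => topFullGroup.swap 1 {x | lampFun α.1 B v.toAdd x ≠ 0}
    (isClopen_lampFun_ne_zero α.1 hB _) fun x hx h => hU x (lampFun_ne_zero_subset hBU hαU _ hx)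
      (lampFun_ne_zero_subset hBU hαU _ h)) fun v w => by
      refine (topFullGroup.swap_mul_swap hU (lampFun_ne_zero_subset hBU hαU _)
        (lampFun_ne_zero_subset hBU hαU _) fun x => ?_).symm
      simp only [toAdd_mul, map_add, Set.mem_ofPred_eq, Pi.add_apply]
      generalize lampFun α.1 B v.toAdd x = a
      generalize lampFun α.1 B w.toAdd x = b
      revert a b
      decide

theorem exists_lampHom_eq_swap (hU : ∀ x ∈ U, (φ ^ (1 : ℤ)) x ∉ U) (hB : IsClopen B) (hBU : B ⊆ U)
    (hαU : ∀ (k : ℤ) x, (α.1 ^ k) x ∈ U ↔ x ∈ U) (v : Multiplicative (ℤ →₀ ZMod 2)) :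
    ∃ hE hd, lampHom hU hB hBU hαU v =
      topFullGroup.swap 1 {x | lampFun α.1 B v.toAdd x ≠ 0} hE hd :=
  ⟨isClopen_lampFun_ne_zero α.1 hB _, fun x hx h => hU x (lampFun_ne_zero_subset hBU hαU _ hx)
      (lampFun_ne_zero_subset hBU hαU _ h), rfl⟩

/-- A trivial swap has empty support set, so `v` is a linear relation between translates of the
indicator of `B`, which would make `B` periodic. -/
theorem lampHom_injective {hU : ∀ x ∈ U, (φ ^ (1 : ℤ)) x ∉ U} {hB : IsClopen B} {hBU : B ⊆ U}
    {hαU : ∀ (k : ℤ) x, (α.1 ^ k) x ∈ U ↔ x ∈ U}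
    (hper : ¬ ∃ N > (0 : ℤ), ∀ x, (α.1 ^ N) x ∈ B ↔ x ∈ B) :
    Function.Injective (lampHom hU hB hBU hαU) := by
  classical
  refine (injective_iff_map_eq_one _).2 fun v hv => ?_
  by_contra hne
  refine hper ?_
  obtain ⟨N, hN, h⟩ := exists_periodic_of_linearCombination_eq_zero (α := α.1)
    (f := fun x => if x ∈ B then 1 else 0) (v := v.toAdd) hne (funext fun x => by
      by_contra hx
      have h1 : lampFun α.1 B v.toAdd x ≠ 0 := hx
      have h2 : (lampHom hU hB hBU hαU v).1 x = (φ ^ (1 : ℤ)) x := by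
        obtain ⟨hE, hd, heq⟩ := exists_lampHom_eq_swap hU hB hBU hαU v
        rw [heq, topFullGroup.swap_apply_of_mem h1]
      rw [hv] at h2
      have hxU : x ∈ U := not_not.1 fun h => h1 (lampFun_eq_zero hBU hαU _ h)
      exact hU x hxU (h2 ▸ hxU))
  refine ⟨N, hN, fun x => ?_⟩
  have := h x
  by_cases h1 : (α.1 ^ N) x ∈ B <;> by_cases h2 : x ∈ B <;> simp_all

/-- The subgroup of homeomorphisms in the topological full group supported on `W`. -/
def supportedSubgroup (φ : X ≃ₜ X) (W : Set X) : Subgroup (topFullGroup φ) where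
  carrier := {g | ∀ x ∉ W, g.1 x = x}
  mul_mem' := fun {a b} ha hb x hx => by
    rw [Subgroup.coe_mul, Homeomorph.mul_apply, hb x hx, ha x hx]
  one_mem' := fun _ _ => rfl
  inv_mem' := fun {a} ha x hx => by
    have h := ha x hx
    conv_lhs => rw [← h]
    exact a.1.symm_apply_apply x

theorem commute_and_eq_one_of_disjoint {a b : topFullGroup φ}
    (h : ∀ x, a.1 x = x ∨ b.1 x = x) : Commute a b ∧ (a * b = 1 → a = 1) := by
  have hdisj : Equiv.Perm.Disjoint a.1.toEquiv b.1.toEquiv := h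
  refine ⟨Subtype.ext (Homeomorph.ext fun x => DFunLike.congr_fun hdisj.commute.eq x),
    fun hab => Subtype.ext (Homeomorph.ext fun x => ?_)⟩
  have h1 : a.1.toEquiv * b.1.toEquiv = 1 :=
    Equiv.ext fun x => DFunLike.congr_fun (congrArg Subtype.val hab) x
  exact DFunLike.congr_fun (hdisj.mul_eq_one_iff.1 h1).1 x

/-- Conjugating by the swap of `W` with its translate moves the support off `W`, so the two copies
commute and meet trivially. -/
theorem containsLamplighter_commutator_of_supported {ι : Lamplighter →* topFullGroup φ}
    (hι : Function.Injective ι) {W : Set X} (hW : IsClopen W) {n : ℤ}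
    (hn : ∀ x ∈ W, (φ ^ n) x ∉ W) (hsupp : ∀ l, ι l ∈ supportedSubgroup φ W) :
    ContainsLamplighter (commutator (topFullGroup φ)) := by
  set s := topFullGroup.swap n W hW hn with hs
  have hdisj : ∀ l l' x, (ι l).1 x = x ∨ (s * ι l' * s⁻¹).1 x = x := fun l l' x => by
    by_cases hx : x ∈ W
    · right
      have hsx : s.1 ((s⁻¹).1 x) = x := s.1.apply_symm_apply x
      have hnot : (s⁻¹).1 x ∉ W := fun h => by
        rw [hs, topFullGroup.swap_apply_of_mem h] at hsx
        exact hn _ h (hsx.symm ▸ hx)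
      rw [Subgroup.coe_mul, Subgroup.coe_mul, Homeomorph.mul_apply, Homeomorph.mul_apply,
        hsupp l' _ hnot, hsx]
    · exact Or.inl (hsupp l x hx)
  exact containsLamplighter_commutator hι s
    (fun l l' => (commute_and_eq_one_of_disjoint (hdisj l l')).1)
    (fun l l' => (commute_and_eq_one_of_disjoint (hdisj l l')).2)

/-- An element of the topological full group preserving a clopen set `U`, disjoint from `φ U`, for
which some clopen subset of `U` is not periodic gives rise to a lamplighter group. -/
theorem exists_lamplighter_hom (hU : ∀ x ∈ U, (φ ^ (1 : ℤ)) x ∉ U) (hB : IsClopen B) (hBU : B ⊆ U)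
    (hmem : ∀ x ∈ U, α.1 x ∈ U) (hfix : ∀ x ∉ U, α.1 x = x)
    (hper : ¬ ∃ N > (0 : ℤ), ∀ x, (α.1 ^ N) x ∈ B ↔ x ∈ B) :
    ∃ ι : Lamplighter →* topFullGroup φ, Function.Injective ι ∧
      ∀ l, ι l ∈ supportedSubgroup φ (U ∪ φ.symm ⁻¹' U) := by
  have hαU := zpow_mem_iff_of_forall hmem hfix
  have hU1 : ∀ x ∈ U, φ x ∉ U := by simpa only [zpow_one] using hU
  have hφ : φ ∈ topFullGroup φ := ⟨fun _ => 1, continuous_const, fun x => by rw [zpow_one]⟩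
  set t : topFullGroup φ := ⟨φ, hφ⟩
  -- `g` acts as `α` on `U` and as its `φ`-conjugate on `φ U`; moving both floors together is what
  -- lets it conjugate swaps to swaps.
  set g : topFullGroup φ := α * (t * α * t⁻¹)
  have hgx : ∀ x, g.1 x = α.1 (φ (α.1 (φ.symm x))) := fun x => rfl
  have hgU : ∀ x ∈ U, g.1 x = α.1 x := fun x hx => by
    have : φ.symm x ∉ U := fun h => hU1 _ h ((φ.apply_symm_apply x).symm ▸ hx)
    rw [hgx, hfix _ this, φ.apply_symm_apply]
  have hgφU : ∀ x ∈ U, g.1 (φ x) = φ (α.1 x) := fun x hx => by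
    rw [hgx, φ.symm_apply_apply, hfix _ (hU1 _ (hmem x hx))]
  have hgnot : ∀ x ∉ U, φ.symm x ∉ U → g.1 x = x := fun x hx hx' => by
    rw [hgx, hfix _ hx', φ.apply_symm_apply, hfix x hx]
  have hgmem : ∀ x ∉ U, g.1 x ∉ U := fun x hx => by
    by_cases hx' : φ.symm x ∈ U
    · have := hgφU _ hx'
      rw [φ.apply_symm_apply] at this
      rw [this]
      exact hU1 _ (hmem _ hx')
    · rwa [hgnot x hx hx']
  have hshift : ∀ v, lampHom hU hB hBU hαU (lampShift (Multiplicative.ofAdd 1) v) =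
      g * lampHom hU hB hBU hαU v * g⁻¹ := fun v => by
    obtain ⟨hE, hd, heq⟩ := exists_lampHom_eq_swap hU hB hBU hαU v
    obtain ⟨hE', hd', heq'⟩ :=
      exists_lampHom_eq_swap hU hB hBU hαU (lampShift (Multiplicative.ofAdd 1) v)
    rw [heq, heq']
    refine topFullGroup.mul_swap_mul_inv g (fun x hx => ?_) (fun x => ?_)
    · have hxU : x ∈ U := not_not.1 fun h => hx (lampFun_eq_zero hBU hαU _ h)
      rw [zpow_one, hgφU x hxU, hgU x hxU]
    · rw [Set.mem_ofPred_eq, Set.mem_ofPred_eq]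
      by_cases hx : x ∈ U
      · rw [hgU x hx, lampFun_lampShift]
      · rw [lampFun_eq_zero hBU hαU _ hx, lampFun_eq_zero hBU hαU _ (hgmem x hx)]
  refine ⟨Lamplighter.lift _ g hshift, Lamplighter.lift_injective hshift (lampHom_injective hper),
    fun l => ?_⟩
  rw [Lamplighter.lift_apply]
  refine mul_mem (fun x hx => ?_) (zpow_mem (fun x hx => ?_) _)
  · obtain ⟨hE, hd, heq⟩ := exists_lampHom_eq_swap hU hB hBU hαU l.left
    rw [heq]
    refine topFullGroup.swap_apply_of_notMem
      (fun h => h (lampFun_eq_zero hBU hαU _ fun hxU => hx (Or.inl hxU)))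
      (fun y hy hyx => hx (Or.inr ?_))
    rw [zpow_one] at hyx
    rw [Set.mem_preimage, ← hyx, φ.symm_apply_apply]
    exact not_not.1 fun h => hy (lampFun_eq_zero hBU hαU _ h)
  · exact hgnot x (fun h => hx (Or.inl h)) fun h => hx (Or.inr h)

end Lamps

/-! ### Assembling the equivalence -/

theorem containsLamplighter_commutator_of_not_isOdometer {X : Type*} [TopologicalSpace X]
    [TopologicalSpace.MetrizableSpace X] [CompactSpace X] [TotallyDisconnectedSpace X]
    [PerfectSpace X] [Nonempty X] {φ : X ≃ₜ X} (hφ : IsMinimalHomeo φ) (h : ¬ IsOdometer φ) :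
    ContainsLamplighter (commutator (topFullGroup φ)) := by
  -- Three translates suffice: the copy lives on `U ∪ φ U`, which `φ ^ 2` must move to the disjoint
  -- set `φ² U ∪ φ³ U`.
  obtain ⟨U, hU, hne, hdisj⟩ := hφ.exists_isClopen_disjoint_translates 3
  obtain ⟨α, r, hr, hr0, hα, hfix⟩ := exists_firstReturn hφ hU hne
  have hsweep : ∀ y, ∃ j : ℕ, ∃ x ∈ U, (φ ^ (j : ℤ)) x = y := fun y => by
    obtain ⟨j, -, hj⟩ := hφ.inv.exists_pos_zpow_mem hU.isOpen hne y
    refine ⟨j, _, hj, ?_⟩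
    rw [inv_zpow', ← zpow_add_apply, add_neg_cancel, zpow_zero, Homeomorph.one_apply]
  obtain ⟨B, hBU, hB, hper⟩ : ∃ B ⊆ U, IsClopen B ∧
      ¬ ∃ N > (0 : ℤ), ∀ x, (α.1 ^ N) x ∈ B ↔ x ∈ B := by
    by_contra! hcon
    exact h (isOdometer_of_forall_isClopen_periodic hφ fun A hA =>
      exists_period_of_firstReturn hU hr hr0 hα hfix hsweep
        (fun B hBU hB => hcon B hBU hB) hA)
  have hU' : ∀ n : ℤ, 0 < n → n ≤ 3 → ∀ x ∈ U, (φ ^ n) x ∉ U := hdisj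
  obtain ⟨ι, hι, hsupp⟩ := exists_lamplighter_hom (hU' 1 (by norm_num) (by norm_num)) hB hBU
    (fun x hx => (hα x hx).2) hfix hper
  refine containsLamplighter_commutator_of_supported hι
    (hU.union (hU.preimage φ.symm.continuous)) (n := 2) ?_ hsupp
  have hsymm : ∀ z, φ.symm z = (φ ^ (-1 : ℤ)) z := fun z => by rw [zpow_neg_one]; rfl
  rintro x (hx | hx) (hx' | hx')
  · exact hU' 2 (by norm_num) (by norm_num) x hx hx'
  · rw [Set.mem_preimage, hsymm, ← zpow_add_apply] at hx'
    exact hU' 1 (by norm_num) (by norm_num) x hx hx'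
  · rw [Set.mem_preimage] at hx
    refine hU' 3 (by norm_num) (by norm_num) _ hx ?_
    rwa [hsymm, ← zpow_add_apply]
  · rw [Set.mem_preimage] at hx hx'
    refine hU' 2 (by norm_num) (by norm_num) _ hx ?_
    rw [hsymm, ← zpow_add_apply] at hx' ⊢
    exact hx'

theorem theorem2p4 {X : Type*} [TopologicalSpace X] [TopologicalSpace.MetrizableSpace X]
    [CompactSpace X] [TotallyDisconnectedSpace X] [PerfectSpace X] [Nonempty X]
    (φ : X ≃ₜ X) (hφ : IsMinimalHomeo φ) :
    List.TFAE [
      ¬ IsOdometer φ,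
      ContainsLamplighter (commutator (topFullGroup φ)),
      ContainsLamplighter (topFullGroup φ)] := by
  tfae_have 1 → 2 := containsLamplighter_commutator_of_not_isOdometer hφ
  tfae_have 2 → 3 := fun h => by
    obtain ⟨ι, hι⟩ := containsLamplighter_iff.1 h
    exact containsLamplighter_iff.2 ⟨(Subgroup.subtype _).comp ι,
      (Subgroup.subtype_injective _).comp hι⟩
  tfae_have 3 → 1 := fun h h' => h'.not_containsLamplighter h
  tfae_finish
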